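/- Let $p \neq \ell$ be primes, let $k$ be an algebraic closure of $\mathbb{F}_p$, and let $I$ be the absolute Galois group of the field of formal Laurent series over $k$. Continuous finite-dimensional $\overline{\mathbb{Q}}_\ell$-representations of $I$ are identified with lisse $\overline{\mathbb{Q}}_\ell$-sheaves on the formal punctured disc $\eta$. Such a sheaf is tamely ramified if the wild ramification subgroup (the absolute Galois group of the maximal tamely ramified extension $\bigcup_{(m,p)=1} k((t^{1/m}))$ of $k((t))$) acts trivially. Fix a non-trivial additive character $\psi : \mathbb{F}_p \to \overline{\mathbb{Q}}_\ell^{*}$; for a Laurent series $f$ let $\chi_f : I \to \overline{\mathbb{Q}}_\ell^{*}$, $\chi_f(\sigma) = \psi(\sigma(y) - y)$ with $y^p - y = f$, be the character associated to the Artin–Schreier sheaf $\mathcal{L}_\psi(f)$. Let $r \geq 1$ be an integer prime to $p$, let $[r] : \eta \to \eta$ be the covering $u \mapsto u^r = t$ (from the disc with coordinate $u$ to the disc with coordinate $t$), let $\varphi(u) \in k[u^{-1}]$, and let $\mathcal{K}$ be a tamely ramified $\overline{\mathbb{Q}}_\ell$-sheaf of rank $n$ on $\eta$. Then the representation $\rho$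 of $I$ associated to $$[r]_*\bigl(\mathcal{L}_\psi(\varphi(u)) \otimes \mathcal{K}\bigr)$$ is finite-dimensional, and $$\det(\rho) = \chi_2^{(r-1)n} \cdot \chi_{n \operatorname{Tr} \varphi(t)} \otimes \det(\mathcal{K}).$$ Here $\chi_2 : \sigma \mapsto \sigma(\sqrt{t})/\sqrt{t} \in \{\pm 1\}$ is the quadratic character of $I$ (for $p = 2$, where $(r-1)n$ is even, $\chi_2$ is understood to be trivial), $\operatorname{Tr}\varphi(t) \in k((t))$ is the trace of $\varphi(u)$ for the extension $k((t)) \subset k((u))$, $t = u^r$, and $\det(\mathcal{K})$ is the determinant of $\mathcal{K}$ as a representation of $I$, where on the right-hand side the coordinate of $\eta$ is named $t$ (that is, the discs with coordinates $u$ and $t$ are identified by renaming $u$ to $t$). -/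

import Mathlib

open scoped LaurentSeries Polynomial

noncomputable section

namespace WildLocal

/-! ### Characters of the absolute Galois group of a field

`Ω` is a separable closure of `F`, and `Gal(Ω/F) = Ω ≃ₐ[F] Ω` is the absolute Galois group. -/

section Characters

variable {F Ω E : Type*} [Field F] [Field Ω] [Algebra F Ω] [Field E]

theorem exists_artinSchreier_root [IsSepClosure F Ω] (p : ℕ) [hp : Fact p.Prime] [Algebra (ZMod p) F] (f : F) :
    ∃ y : Ω, y ^ p - y = algebraMap F Ω f := by
  have : IsSepClosed Ω := IsSepClosure.sep_closed F
  have : CharP F p := charP_of_injective_algebraMap (algebraMap (ZMod p) F).injective p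
  have : CharP Ω p := charP_of_injective_algebraMap (algebraMap F Ω).injective p
  obtain ⟨y, hy⟩ := IsSepClosed.exists_root_C_mul_X_pow_add_C_mul_X_add_C' p p
    (1 : Ω) (-1) (-(algebraMap F Ω f)) dvd_rfl hp.out.two_le (by simp)
  exact ⟨y, by linear_combination hy⟩

/-- If `y ^ p - y = f` lies in the base field, then `σ y - y` lies in the prime field. -/
theorem exists_artinSchreier_difference (p : ℕ) [hp : Fact p.Prime] [Algebra (ZMod p) F]
    {f : F} {y : Ω} (hy : y ^ p - y = algebraMap F Ω f) (σ : Ω ≃ₐ[F] Ω) :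
    ∃ a : ZMod p, algebraMap F Ω (algebraMap (ZMod p) F a) = σ y - y := by
  have : CharP F p := charP_of_injective_algebraMap (algebraMap (ZMod p) F).injective p
  have : CharP Ω p := charP_of_injective_algebraMap (algebraMap F Ω).injective p
  have h1 : (σ y - y) ^ p = σ y - y := by
    have h2 := congrArg σ hy
    rw [map_sub, map_pow, AlgEquiv.commutes] at h2
    rw [sub_pow_char]
    linear_combination h2 - hy
  have h3 := (Subfield.mem_bot_iff_pow_eq_self (F := Ω) (p := p)).2 h1
  have h4 : (⊥ : Subfield Ω) ≤ ((algebraMap F Ω).comp (algebraMap (ZMod p) F)).fieldRange := bot_le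
  obtain ⟨a, ha⟩ := h4 h3
  exact ⟨a, ha⟩

variable [IsSepClosure F Ω]

/-- A chosen root `y` of the Artin-Schreier equation `y ^ p - y = f`. -/
def artinSchreierRoot (Ω : Type*) [Field Ω] [Algebra F Ω] [IsSepClosure F Ω] (p : ℕ) [Fact p.Prime] [Algebra (ZMod p) F] (f : F) : Ω :=
  (exists_artinSchreier_root (Ω := Ω) p f).choose

theorem artinSchreierRoot_spec (p : ℕ) [Fact p.Prime] [Algebra (ZMod p) F] (f : F) :
    artinSchreierRoot Ω p f ^ p - artinSchreierRoot Ω p f = algebraMap F Ω f :=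
  (exists_artinSchreier_root (Ω := Ω) p f).choose_spec

/-- The element `σ y - y` of `𝔽_p`, where `y ^ p - y = f`. -/
def artinSchreierDifference (p : ℕ) [Fact p.Prime] [Algebra (ZMod p) F] (f : F)
    (σ : Ω ≃ₐ[F] Ω) : ZMod p :=
  (exists_artinSchreier_difference p (artinSchreierRoot_spec (Ω := Ω) p f) σ).choose

theorem artinSchreierDifference_spec (p : ℕ) [Fact p.Prime] [Algebra (ZMod p) F] (f : F)
    (σ : Ω ≃ₐ[F] Ω) :
    algebraMap F Ω (algebraMap (ZMod p) F (artinSchreierDifference p f σ)) =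
      σ (artinSchreierRoot Ω p f) - artinSchreierRoot Ω p f :=
  (exists_artinSchreier_difference p (artinSchreierRoot_spec (Ω := Ω) p f) σ).choose_spec

/-- The character of `Gal(Ω/F)` attached to the Artin-Schreier sheaf `𝓛_ψ(f)`, the pull-back
of `𝓛_ψ` along `f : Spec F → 𝔸¹`: it is `σ ↦ ψ (σ y - y)` where `y ^ p - y = f`. -/
def artinSchreierChar (p : ℕ) [Fact p.Prime] [Algebra (ZMod p) F] (ψ : AddChar (ZMod p) E)
    (f : F) : (Ω ≃ₐ[F] Ω) →* E where
  toFun σ := ψ (artinSchreierDifference p f σ)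
  map_one' := by
    have h := artinSchreierDifference_spec p f (1 : Ω ≃ₐ[F] Ω)
    rw [AlgEquiv.one_apply, sub_self, map_eq_zero, map_eq_zero] at h
    rw [h, AddChar.map_zero_eq_one]
  map_mul' σ τ := by
    rw [← AddChar.map_add_eq_mul]
    congr 1
    apply (algebraMap (ZMod p) F).injective
    apply (algebraMap F Ω).injective
    have h := congrArg σ (artinSchreierDifference_spec p f τ)
    rw [map_sub, AlgEquiv.commutes] at h
    rw [map_add, map_add, artinSchreierDifference_spec, artinSchreierDifference_spec, h,
      AlgEquiv.mul_apply]
    ring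

/-- The quadratic (Kummer) character `σ ↦ σ (√f) / √f ∈ {1, -1}` of `Gal(Ω/F)` attached to
`f : F`. In characteristic two it is the trivial character. -/
def quadraticChar (E : Type*) [Field E] (f : F) : (Ω ≃ₐ[F] Ω) →* E where
  toFun σ := open Classical in if ∀ s : Ω, s ^ 2 = algebraMap F Ω f → σ s = s then 1 else -1
  map_one' := by simp
  map_mul' σ τ := by
    classical
    by_cases hs : ∃ s : Ω, s ^ 2 = algebraMap F Ω f
    · obtain ⟨s, hs⟩ := hs
      have hpm : ∀ ρ : Ω ≃ₐ[F] Ω, ρ s = s ∨ ρ s = -s := fun ρ => by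
        have h := congrArg ρ hs
        rw [map_pow, AlgEquiv.commutes, ← hs] at h
        exact sq_eq_sq_iff_eq_or_eq_neg.1 h
      have hiff : ∀ ρ : Ω ≃ₐ[F] Ω,
          (∀ s : Ω, s ^ 2 = algebraMap F Ω f → ρ s = s) ↔ ρ s = s := fun ρ =>
        ⟨fun h => h s hs, fun h s' hs' => by
          rcases sq_eq_sq_iff_eq_or_eq_neg.1 (hs'.trans hs.symm) with h' | h' <;>
            simp [h', h]⟩
      rw [if_congr (hiff (σ * τ)) rfl rfl, if_congr (hiff σ) rfl rfl, if_congr (hiff τ) rfl rfl,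
        AlgEquiv.mul_apply]
      by_cases hneg : -s = s
      · have hfix : ∀ ρ : Ω ≃ₐ[F] Ω, ρ s = s := fun ρ => (hpm ρ).elim id fun h => h.trans hneg
        simp [hfix]
      · rcases hpm σ with h1 | h1 <;> rcases hpm τ with h2 | h2 <;> simp [h1, h2, hneg]
    · have h : ∀ ρ : Ω ≃ₐ[F] Ω, ∀ s : Ω, s ^ 2 = algebraMap F Ω f → ρ s = s :=
        fun ρ s h => (hs ⟨s, h⟩).elim
      rw [if_pos (h (σ * τ)), if_pos (h σ), if_pos (h τ), mul_one]

/-- The trace of `x` for the field extension `f : K → L`. -/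
def traceAlong {K L : Type*} [Field K] [Field L] (f : K →+* L) (x : L) : K :=
  letI := f.toAlgebra
  Algebra.trace K L x

end Characters

/-! ### Representations -/

section Representations

variable {E G V : Type*} [Field E] [Group G] [AddCommGroup V] [Module E V]

/-- The tensor product `χ ⊗ ρ` of a representation with a one-dimensional character. -/
def twist (χ : G →* E) (ρ : Representation E G V) : Representation E G V where
  toFun g := χ g • ρ g
  map_one' := by simp
  map_mul' g h := by rw [map_mul, map_mul, smul_mul_smul_comm]

/-- Continuity of a (finite-dimensional) representation, expressed by its matrix coefficients. -/
def IsContinuousRep [TopologicalSpace E] [TopologicalSpace G] (ρ : Representation E G V) : Prop :=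
  ∀ (v : V) (w : Module.Dual E V), Continuous fun g => w (ρ g v)

end Representations

/-! ### The formal punctured disc

`η = Spec k((X))`, where `k((X))` is `LaurentSeries k`. The coordinate `X` is called `u` on the
source and `t` on the target of the covering `[r] : η → η`, `u ↦ u ^ r = t`.
The group `I = Gal(Ω/k((X)))` is the inertia group. -/

section Disc

variable (k : Type*) [Field k]

/-- The coordinate on the formal punctured disc. -/
def coord : LaurentSeries k := HahnSeries.single 1 1

/-- The homomorphism `k((t)) → k((u))`, `f(t) ↦ f(u ^ r)`, defining `[r] : η → η`. -/
def powSubst (r : ℕ) (hr : 0 < r) : LaurentSeries k →+* LaurentSeries k :=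
  HahnSeries.embDomainRingHom (AddMonoidHom.mulLeft (r : ℤ))
    (fun a b h => by
      have hr' : (0 : ℤ) < r := by exact_mod_cast hr
      exact mul_left_cancel₀ hr'.ne' h)
    (fun a b => by
      have hr' : (0 : ℤ) < r := by exact_mod_cast hr
      exact mul_le_mul_iff_right₀ hr')

variable (Ω : Type*) [Field Ω] [Algebra (LaurentSeries k) Ω]

/-- The maximal tamely ramified extension of `k((X))` inside `Ω` (for `k` algebraically closed of
characteristic `p`): the union of the fields `k((X ^ (1 / n)))` over all `n` prime to `p`. -/
def tameClosure (p : ℕ) : IntermediateField (LaurentSeries k) Ω :=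
  IntermediateField.adjoin (LaurentSeries k)
    {x : Ω | ∃ n : ℕ, n.Coprime p ∧ x ^ n = algebraMap (LaurentSeries k) Ω (coord k)}

/-- The wild ramification subgroup `P` of the inertia group `I`. -/
def wildInertia (p : ℕ) : Subgroup (Ω ≃ₐ[LaurentSeries k] Ω) :=
  (tameClosure k Ω p).fixingSubgroup

variable {k Ω}

/-- A representation of `I` is tamely ramified if the wild ramification subgroup acts trivially. -/
def IsTame {E V : Type*} [Field E] [AddCommGroup V] [Module E V] (p : ℕ)
    (ρ : Representation E (Ω ≃ₐ[LaurentSeries k] Ω) V) : Prop :=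
  ∀ σ ∈ wildInertia k Ω p, ρ σ = 1

/-- The injective homomorphism `I → I` induced by `[r] : η → η` on fundamental groups; its image is
the open subgroup `I(r)` of index `r`. It depends, up to inner automorphisms, on an extension `Θ`
of `k((t)) → k((u))`, `t ↦ u ^ r`, to the separable closures, and it is `σ ↦ Θ⁻¹ ∘ σ ∘ Θ`. -/
def coverHom {r : ℕ} {hr : 0 < r} (Θ : Ω ≃+* Ω)
    (hΘ : ∀ f : LaurentSeries k, Θ (algebraMap (LaurentSeries k) Ω f) =
      algebraMap (LaurentSeries k) Ω (powSubst k r hr f)) :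
    (Ω ≃ₐ[LaurentSeries k] Ω) →* (Ω ≃ₐ[LaurentSeries k] Ω) where
  toFun σ := AlgEquiv.ofRingEquiv (f := (Θ.trans σ.toRingEquiv).trans Θ.symm) fun f => by
    change Θ.symm (σ (Θ (algebraMap (LaurentSeries k) Ω f))) = algebraMap (LaurentSeries k) Ω f
    rw [hΘ, AlgEquiv.commutes, ← hΘ, RingEquiv.symm_apply_apply]
  map_one' := by ext x; simp
  map_mul' σ τ := by ext x; simp

/-- The direct image `[r]_*`: for the Galois representation `ρ` of a sheaf on the disc with
coordinate `u`, this is the representation (co)induced along `I ≃ I(r) ⊆ I`, i.e. on the functions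
`f : I → V` with `f (ι(g) h) = ρ(g) f(h)`, where `ι` is the homomorphism `coverHom`.
As `I(r)` has finite index `r` in `I`, induction and coinduction agree. -/
abbrev directImage {E V : Type*} [Field E] [AddCommGroup V] [Module E V] {r : ℕ} {hr : 0 < r}
    (Θ : Ω ≃+* Ω)
    (hΘ : ∀ f : LaurentSeries k, Θ (algebraMap (LaurentSeries k) Ω f) =
      algebraMap (LaurentSeries k) Ω (powSubst k r hr f))
    (ρ : Representation E (Ω ≃ₐ[LaurentSeries k] Ω) V) :
    Representation E (Ω ≃ₐ[LaurentSeries k] Ω) (Representation.coindV (coverHom Θ hΘ) ρ) :=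
  Representation.coind (coverHom Θ hΘ) ρ

end Disc

end WildLocal

end

/-!
Let `G = Gal(Ω/k((X)))`, let `ι = coverHom Θ hΘ : G → G`, `τ ↦ Θ⁻¹ τ Θ`, and `x = Θ⁻¹(X)`, so that
`x ^ r = X`. The image of `ι` is the kernel of the Kummer character `c : G → μ_r`, `c σ = σ x / x`
(`ker_kummerChar_eq_range_coverHom`), which is surjective (`kummerChar_surjective`). With a section
`s` of `c`, values at the coset representatives `s a` identify a coinduced representation with
`μ_r → V`, on which `σ` acts by a block-monomial matrix: it permutes the blocks by multiplication
by `c σ`, and its `a`-th block is the action of the `τ a ∈ G` with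
`ι (τ a) = s a * σ * (s (a * c σ))⁻¹`. Hence (`det_coind`) the determinant is the `n`-th power of
the sign of the permutation times `∏ a, det (ρ (τ a))`, a transfer. The three factors of the
formula come from three computations.

* Since `μ_r` is cyclic, a generator acts on it by an `r`-cycle, of sign `(-1) ^ (r - 1)`; comparing
  with the action on `√X = x ^ (r / 2)` shows that the sign is `χ₂ ^ (r - 1)`
  (`sign_mulRight_kummerChar`).
* If `y ^ p - y = f`, then `w = ∑ a, (s a)⁻¹ (Θ⁻¹ y)` satisfies `w ^ p - w = Tr f`, as the maps
  `(s a)⁻¹ ∘ Θ⁻¹` are the embeddings of `k((u))` over `k((t))`, and the sum of the `τ a y - y`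
  telescopes to `σ w - w` (`prod_artinSchreierChar_pow`).
* The tame quotient of `G` is embedded in a commutative group by the characters `σ ↦ σ y / y` with
  `y ^ m = X` and `m` prime to `p`. On it both `ι` and the transfer to the image of `ι` are the
  `r`-th power map, so `∏ a, δ (τ a) = δ σ` for every tame character `δ` (`prod_tame_eq`). This is
  applied to `δ = det κ`.
-/

namespace WildLocal

/-! ### Determinants of coinduced representations -/

section Coinduced

theorem det_funLeft_perm {E V R : Type*} [Field E] [AddCommGroup V] [Module E V]
    [FiniteDimensional E V] [Fintype R] [DecidableEq R] (π : Equiv.Perm R) :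
    LinearMap.det (LinearMap.funLeft E V π) =
      ((Equiv.Perm.sign π : ℤ) : E) ^ Module.finrank E V := by
  have hscalar : LinearMap.det (LinearMap.funLeft E E π) = ((Equiv.Perm.sign π : ℤ) : E) := by
    rw [← LinearMap.det_toMatrix', ← Matrix.det_permutation]
    congr 1
    ext i j
    simp [LinearMap.toMatrix'_apply, LinearMap.funLeft_apply, Pi.single_apply,
      Equiv.Perm.permMatrix, PEquiv.toMatrix_apply, eq_comm]
  let b := Module.finBasis E V
  let e : (R → V) ≃ₗ[E] (Fin (Module.finrank E V) → R → E) :=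
    { toFun := fun v j i => b.equivFun (v i) j
      invFun := fun w i => b.equivFun.symm fun j => w j i
      map_add' := fun v w => by ext; simp
      map_smul' := fun a v => by ext; simp
      left_inv := fun v => by ext i; simp
      right_inv := fun w => by
        ext j i
        exact congrFun (b.equivFun.apply_symm_apply fun j => w j i) j }
  have hconj : (e : (R → V) →ₗ[E] _) ∘ₗ LinearMap.funLeft E V π ∘ₗ
        (e.symm : (Fin (Module.finrank E V) → R → E) →ₗ[E] (R → V)) =
      LinearMap.pi fun j => LinearMap.funLeft E E π ∘ₗ LinearMap.proj j := by
    refine LinearMap.ext fun w => funext fun j => funext fun i => ?_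
    exact congrFun (b.equivFun.apply_symm_apply fun j => w j (π i)) j
  rw [← LinearMap.det_conj _ e, hconj, LinearMap.det_pi]
  simp [hscalar]

/-- The determinant of a block-monomial endomorphism. -/
theorem det_pi_comp_proj_perm {E V R : Type*} [Field E] [AddCommGroup V] [Module E V]
    [FiniteDimensional E V] [Fintype R] [DecidableEq R] (A : R → Module.End E V)
    (π : Equiv.Perm R) :
    LinearMap.det (LinearMap.pi fun i => A i ∘ₗ LinearMap.proj (π i) : (R → V) →ₗ[E] (R → V)) =
      ((Equiv.Perm.sign π : ℤ) : E) ^ Module.finrank E V * ∏ i, LinearMap.det (A i) := by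
  have h : (LinearMap.pi fun i => A i ∘ₗ LinearMap.proj (π i) : (R → V) →ₗ[E] (R → V)) =
      (LinearMap.pi fun i => A i ∘ₗ LinearMap.proj i) ∘ₗ LinearMap.funLeft E V π := rfl
  rw [h, LinearMap.det_comp, LinearMap.det_pi, det_funLeft_perm, mul_comm]

variable {E V G G' M : Type*} [Field E] [AddCommGroup V] [Module E V] [Group G] [Group G']
  [Group M] {ι : G' →* G} {c : G →* M} {s : M → G}

theorem exists_map_eq_mul_section_inv (hker : c.ker = ι.range) (hs : ∀ a, c (s a) = a) (g : G) :
    ∃ τ, ι τ = g * (s (c g))⁻¹ := by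
  have : g * (s (c g))⁻¹ ∈ c.ker := by simp [MonoidHom.mem_ker, hs]
  rwa [hker] at this

/-- A coinduced representation has the values at representatives of the cosets as coordinates. -/
noncomputable def coindVEquivPi (hι : Function.Injective ι) (hker : c.ker = ι.range)
    (hs : ∀ a, c (s a) = a) (ρ : Representation E G' V) :
    Representation.coindV ι ρ ≃ₗ[E] (M → V) where
  toFun f a := f.1 (s a)
  map_add' _ _ := rfl
  map_smul' _ _ := rfl
  invFun v := ⟨fun g => ρ (exists_map_eq_mul_section_inv hker hs g).choose (v (c g)), by
    intro τ g
    have hτ : c (ι τ) = 1 := by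
      rw [← MonoidHom.mem_ker, hker]
      exact ⟨τ, rfl⟩
    have h1 := (exists_map_eq_mul_section_inv hker hs g).choose_spec
    have h2 := (exists_map_eq_mul_section_inv hker hs (ι τ * g)).choose_spec
    have hc : c (ι τ * g) = c g := by rw [map_mul, hτ, one_mul]
    have h3 : (exists_map_eq_mul_section_inv hker hs (ι τ * g)).choose =
        τ * (exists_map_eq_mul_section_inv hker hs g).choose := by
      apply hι
      rw [h2, hc, map_mul ι, h1, mul_assoc]
    change ρ _ (v _) = ρ τ (ρ _ (v _))
    rw [h3, hc, map_mul, Module.End.mul_apply]⟩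
  left_inv f := by
    apply Subtype.ext
    funext g
    change ρ _ (f.1 (s (c g))) = f.1 g
    rw [← f.2, (exists_map_eq_mul_section_inv hker hs g).choose_spec, inv_mul_cancel_right]
  right_inv v := by
    funext a
    have h1 := (exists_map_eq_mul_section_inv hker hs (s a)).choose_spec
    have h2 : (exists_map_eq_mul_section_inv hker hs (s a)).choose = 1 := by
      apply hι
      rw [h1, hs, map_one, mul_inv_cancel]
    change ρ _ (v (c (s a))) = v a
    rw [h2, hs, map_one, Module.End.one_apply]

/-- The determinant of a coinduced representation is a permutation sign times the transfer of
the determinant; the elements `ι (τ a)` are the factors of the transfer of `σ`. -/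
theorem det_coind [FiniteDimensional E V] [Fintype M] [DecidableEq M]
    (hι : Function.Injective ι) (hker : c.ker = ι.range) (hs : ∀ a, c (s a) = a)
    (ρ : Representation E G' V) (σ : G) (τ : M → G')
    (hτ : ∀ a, ι (τ a) = s a * σ * (s (a * c σ))⁻¹) :
    LinearMap.det (Representation.coind ι ρ σ) =
      ((Equiv.Perm.sign (Equiv.mulRight (c σ)) : ℤ) : E) ^ Module.finrank E V *
        ∏ a, LinearMap.det (ρ (τ a)) := by
  let e := coindVEquivPi hι hker hs ρ
  rw [← det_pi_comp_proj_perm, ← LinearMap.det_conj (Representation.coind ι ρ σ) e]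
  congr 1
  refine LinearMap.ext fun v => ?_
  obtain ⟨f, rfl⟩ := e.surjective v
  funext a
  change ((Representation.coind ι ρ σ) (e.symm (e f))).1 (s a) = ρ (τ a) (f.1 (s (a * c σ)))
  rw [e.symm_apply_apply, ← f.2, hτ, inv_mul_cancel_right]
  rfl

end Coinduced

theorem sign_mulRight_of_forall_mem_zpowers {M : Type*} [Group M] [Fintype M] [DecidableEq M]
    {g : M} (hg : ∀ a, a ∈ Subgroup.zpowers g) :
    Equiv.Perm.sign (Equiv.mulRight g) = (-1) ^ (Fintype.card M - 1) := by
  rcases subsingleton_or_nontrivial M with h | h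
  · have hc : Fintype.card M = 1 := Fintype.card_eq_one_iff.2 ⟨1, fun a => Subsingleton.elim _ _⟩
    have : Equiv.mulRight g = 1 := Subsingleton.elim _ _
    simp [hc, this]
  · have hg1 : g ≠ 1 := by
      rintro rfl
      obtain ⟨a, ha⟩ := exists_ne (1 : M)
      exact ha (by simpa using hg a)
    have hcyc : (Equiv.mulRight g).IsCycle := by
      refine ⟨1, by simpa using hg1, fun y _ => ?_⟩
      obtain ⟨j, rfl⟩ := hg y
      exact ⟨j, by simp [Equiv.zpow_mulRight]⟩
    have hsupp : (Equiv.mulRight g).support = Finset.univ := by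
      ext a
      simp [hg1]
    rw [hcyc.sign, hsupp, Finset.card_univ]
    obtain ⟨n, hn⟩ := Nat.exists_eq_succ_of_ne_zero (Fintype.card_ne_zero (α := M))
    rw [hn, pow_succ]
    simp

/-! ### Traces and Artin-Schreier characters -/

section General

/-- The trace as a sum over embeddings into a separable extension, for an extension generated by `u`
and as many embeddings, distinct at `u`, as there are powers of `u` in a spanning family. -/
theorem algebraMap_traceAlong_eq_sum {K L Ω M : Type*} [Field K] [Field L] [Field Ω]
    [Algebra K Ω] [Algebra.IsSeparable K Ω] [Fintype M] (f : K →+* L) (j : M → L →+* Ω)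
    (hj : ∀ a x, j a (f x) = algebraMap K Ω x) {u : L}
    (hu : ∀ z, ∃ g : Fin (Fintype.card M) → K, z = ∑ i, f (g i) * u ^ (i : ℕ))
    (hinj : Function.Injective fun a => j a u) (z : L) :
    algebraMap K Ω (traceAlong f z) = ∑ a, j a z := by
  let := f.toAlgebra
  change algebraMap K Ω (Algebra.trace K L z) = _
  have hspan : Submodule.span K (Set.range fun i : Fin (Fintype.card M) => u ^ (i : ℕ)) = ⊤ := by
    refine eq_top_iff.2 fun z _ => ?_
    obtain ⟨g, rfl⟩ := hu z
    refine Submodule.sum_mem _ fun i _ => ?_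
    have : f (g i) * u ^ (i : ℕ) = g i • u ^ (i : ℕ) := (Algebra.smul_def (g i) _).symm
    rw [this]
    exact Submodule.smul_mem _ _ (Submodule.subset_span ⟨i, rfl⟩)
  have hfin : FiniteDimensional K L := by
    rw [FiniteDimensional, Module.finite_def, ← hspan]
    exact Submodule.fg_span (Set.finite_range _)
  have hrank : Module.finrank K L ≤ Fintype.card M := by
    have h := finrank_range_le_card (R := K) fun i : Fin (Fintype.card M) => u ^ (i : ℕ)
    rwa [Set.finrank, hspan, finrank_top, Fintype.card_fin] at h
  let J : M → L →ₐ[K] Ω := fun a => { j a with commutes' := hj a }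
  rcases isEmpty_or_nonempty M with hM | ⟨⟨a₀⟩⟩
  · have := Module.finrank_pos (R := K) (M := L)
    rw [Fintype.card_eq_zero] at hrank
    omega
  have hsep : Algebra.IsSeparable K L := Algebra.IsSeparable.of_algHom K Ω (J a₀)
  let ι : Ω →ₐ[K] AlgebraicClosure Ω := IsScalarTower.toAlgHom K Ω (AlgebraicClosure Ω)
  have hJinj : Function.Injective fun a => ι.comp (J a) := fun a b hab =>
    hinj (ι.injective (DFunLike.congr_fun hab u))
  -- The `card M` given embeddings are all of them, as there are at most `[L : K] ≤ card M`.
  have hJ : Function.Bijective fun a => ι.comp (J a) :=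
    (Fintype.bijective_iff_injective_and_card _).2 ⟨hJinj, le_antisymm
      (Fintype.card_le_of_injective _ hJinj) ((AlgHom.card K L (AlgebraicClosure Ω)).le.trans hrank)⟩
  refine ι.injective ?_
  change ι _ = ι _
  rw [AlgHom.commutes, trace_eq_sum_embeddings (AlgebraicClosure Ω), map_sum]
  exact (hJ.sum_comp fun e : L →ₐ[K] AlgebraicClosure Ω => e z).symm

variable {F Ω E : Type*} [Field F] [Field Ω] [Algebra F Ω] [Field E] [IsSepClosure F Ω]

/-- The Artin-Schreier character may be computed with any root of the Artin-Schreier equation. -/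
theorem artinSchreierChar_apply (p : ℕ) [Fact p.Prime] [Algebra (ZMod p) F]
    (ψ : AddChar (ZMod p) E) {f : F} {w : Ω} (hw : w ^ p - w = algebraMap F Ω f)
    {σ : Ω ≃ₐ[F] Ω} {a : ZMod p} (ha : algebraMap F Ω (algebraMap (ZMod p) F a) = σ w - w) :
    artinSchreierChar p ψ f σ = ψ a := by
  have : CharP F p := charP_of_injective_algebraMap (algebraMap (ZMod p) F).injective p
  have : CharP Ω p := charP_of_injective_algebraMap (algebraMap F Ω).injective p
  have hy := artinSchreierRoot_spec (Ω := Ω) p f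
  have hd := artinSchreierDifference_spec p f σ
  set y := artinSchreierRoot Ω p f
  have h1 : (w - y) ^ p = w - y := by
    rw [sub_pow_char]
    linear_combination hw - hy
  have h3 := (Subfield.mem_bot_iff_pow_eq_self (F := Ω) (p := p)).2 h1
  have h4 : (⊥ : Subfield Ω) ≤ (algebraMap F Ω).fieldRange := bot_le
  obtain ⟨b, hb⟩ := h4 h3
  have h5 : σ (w - y) = w - y := by rw [← hb, AlgEquiv.commutes]
  rw [map_sub] at h5
  change ψ (artinSchreierDifference p f σ) = ψ a
  congr 1
  apply (algebraMap (ZMod p) F).injective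
  apply (algebraMap F Ω).injective
  rw [hd, ha]
  linear_combination -h5

end General

/-! ### Constants and the Kummer covering of the disc -/

section Disc

variable {k : Type*} [Field k]

theorem coord_ne_zero : coord k ≠ 0 := HahnSeries.single_ne_zero one_ne_zero

theorem coord_pow (n : ℕ) : coord k ^ n = HahnSeries.single (n : ℤ) 1 := by
  rw [coord, HahnSeries.single_pow]
  simp

theorem powSubst_C (r : ℕ) (hr : 0 < r) (a : k) :
    powSubst k r hr (HahnSeries.C a) = HahnSeries.C a := HahnSeries.embDomainRingHom_C

theorem powSubst_coord (r : ℕ) (hr : 0 < r) : powSubst k r hr (coord k) = coord k ^ r := by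
  rw [coord_pow]
  exact HahnSeries.embDomain_single.trans (by simp)

theorem coeff_powSubst_mul (r : ℕ) (hr : 0 < r) (f : LaurentSeries k) (n : ℤ) :
    (powSubst k r hr f).coeff (r * n) = f.coeff n :=
  HahnSeries.embDomain_coeff (f := ⟨⟨AddMonoidHom.mulLeft (r : ℤ), _⟩, _⟩)

theorem coeff_powSubst_of_not_dvd (r : ℕ) (hr : 0 < r) (f : LaurentSeries k) {n : ℤ}
    (hn : ¬(r : ℤ) ∣ n) : (powSubst k r hr f).coeff n = 0 :=
  HahnSeries.embDomain_of_notMem_range (by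
    rintro ⟨m, rfl⟩
    exact hn ⟨m, rfl⟩)

/-- `k((u))` is spanned over `k((t))`, `t = u ^ r`, by the powers `u ^ i` with `i < r`: the exponents
are sorted by their residue modulo `r`. -/
theorem exists_eq_sum_powSubst_mul_coord_pow (r : ℕ) (hr : 0 < r) (f : LaurentSeries k) :
    ∃ g : Fin r → LaurentSeries k, f = ∑ i, powSubst k r hr (g i) * coord k ^ (i : ℕ) := by
  have hbdd : ∀ i : Fin r, BddBelow (Function.support fun n : ℤ => f.coeff (r * n + i)) := by
    refine fun i => ⟨-|f.order| - 1, fun n hn => ?_⟩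
    have h1 : f.order ≤ r * n + i := HahnSeries.order_le_of_coeff_ne_zero hn
    by_contra! h2
    have h3 : (1 : ℤ) ≤ r := by exact_mod_cast hr
    have h4 : ((i : ℕ) : ℤ) < r := by exact_mod_cast i.2
    have h5 := neg_abs_le f.order
    have h6 := abs_nonneg f.order
    nlinarith
  refine ⟨fun i => HahnSeries.ofSuppBddBelow _ (hbdd i), ?_⟩
  ext m
  rw [HahnSeries.coeff_sum]
  have hr' : (0 : ℤ) < r := by exact_mod_cast hr
  have hm0 := Int.emod_nonneg m hr'.ne'
  have hm1 := Int.emod_lt_of_pos m hr'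
  have hm2 := Int.mul_ediv_add_emod m r
  rw [Finset.sum_eq_single ⟨(m % r).toNat, by omega⟩]
  · have h : ((m % r).toNat : ℤ) = m % r := Int.toNat_of_nonneg hm0
    rw [coord_pow, HahnSeries.coeff_mul_single, mul_one]
    have h2 : m - ((m % r).toNat : ℤ) = r * (m / r) := by rw [h]; linarith
    change _ = (powSubst k r hr _).coeff (m - ((m % r).toNat : ℤ))
    rw [h2, coeff_powSubst_mul]
    change _ = f.coeff (r * (m / r) + ((m % r).toNat : ℤ))
    rw [h, hm2]
  · intro i _ hi
    rw [coord_pow, HahnSeries.coeff_mul_single, mul_one]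
    refine coeff_powSubst_of_not_dvd r hr _ fun hdvd => hi (Fin.ext ?_)
    have h4 : ((i : ℕ) : ℤ) < r := by exact_mod_cast i.2
    have h6 : m % r = (i : ℕ) := by
      rw [Int.emod_eq_emod_iff_emod_sub_eq_zero.2 (Int.emod_eq_zero_of_dvd hdvd),
        Int.emod_eq_of_lt (by omega) h4]
    change (i : ℕ) = (m % r).toNat
    omega
  · simp

variable {Ω : Type*} [Field Ω] [Algebra (LaurentSeries k) Ω]

theorem exists_isPrimitiveRoot [IsAlgClosed k] {m : ℕ} (hm : (m : k) ≠ 0) :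
    ∃ ζ : k, IsPrimitiveRoot (algebraMap (LaurentSeries k) Ω (HahnSeries.C ζ)) m := by
  have : NeZero (m : k) := ⟨hm⟩
  obtain ⟨ζ, hζ⟩ := HasEnoughRootsOfUnity.exists_primitiveRoot k m
  exact ⟨ζ, hζ.map_of_injective
    (f := (algebraMap (LaurentSeries k) Ω).comp (HahnSeries.C (Γ := ℤ) (R := k)))
    (RingHom.injective _)⟩

theorem exists_algebraMap_C_eq_of_pow_eq_one [IsAlgClosed k] {m : ℕ} (hm : (m : k) ≠ 0) {ω : Ω}
    (hω : ω ^ m = 1) : ∃ a : k, algebraMap (LaurentSeries k) Ω (HahnSeries.C a) = ω := by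
  obtain ⟨ζ, hζ⟩ := exists_isPrimitiveRoot (Ω := Ω) hm
  have : NeZero m := ⟨by rintro rfl; simp at hm⟩
  obtain ⟨i, -, hi⟩ := hζ.eq_pow_of_pow_eq_one hω
  exact ⟨ζ ^ i, by rw [map_pow, map_pow, hi]⟩

theorem natCast_ne_zero_of_coprime {p : ℕ} [hp : Fact p.Prime] [CharP k p] {m : ℕ}
    (hm : m.Coprime p) : (m : k) ≠ 0 := by
  rw [Ne, CharP.cast_eq_zero_iff k p]
  exact (Nat.Prime.coprime_iff_not_dvd hp.out).1 hm.symm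

variable (k Ω) in
/-- The roots `t ^ (1 / m)` of the coordinate, with `m` prime to `p`, which generate the maximal
tamely ramified extension. -/
def tameRoots (p : ℕ) : Set Ω :=
  {x : Ω | ∃ m : ℕ, m.Coprime p ∧ x ^ m = algebraMap (LaurentSeries k) Ω (coord k)}

section Kummer

variable {p : ℕ} [hp : Fact p.Prime]

theorem ne_zero_of_mem_tameRoots {y : Ω} (hy : y ∈ tameRoots k Ω p) : y ≠ 0 := by
  obtain ⟨m, hm, hy⟩ := hy
  rintro rfl
  have hm0 : m ≠ 0 := by
    rintro rfl
    exact hp.out.one_lt.ne' (by simpa using hm)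
  rw [zero_pow hm0] at hy
  exact coord_ne_zero ((map_eq_zero _).1 hy.symm)

variable [IsAlgClosed k] [CharP k p]

theorem exists_algebraMap_C_eq_div {m : ℕ} (hm : m.Coprime p) {x y : Ω}
    (hxy : x ^ m = y ^ m) (hy : y ≠ 0) :
    ∃ a : k, algebraMap (LaurentSeries k) Ω (HahnSeries.C a) = x / y :=
  exists_algebraMap_C_eq_of_pow_eq_one (natCast_ne_zero_of_coprime hm)
    (by rw [div_pow, hxy, div_self (pow_ne_zero _ hy)])

theorem exists_algebraMap_C_eq_apply_div (σ : Ω ≃ₐ[LaurentSeries k] Ω) {y : Ω}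
    (hy : y ∈ tameRoots k Ω p) :
    ∃ a : k, algebraMap (LaurentSeries k) Ω (HahnSeries.C a) = σ y / y := by
  have h0 := ne_zero_of_mem_tameRoots hy
  obtain ⟨m, hm, hy⟩ := hy
  exact exists_algebraMap_C_eq_div hm (by rw [← map_pow, hy, AlgEquiv.commutes]) h0

variable (k Ω p) in
/-- The product of the Kummer characters `σ ↦ σ y / y` of all the roots `y = t ^ (1 / m)`, with `m`
prime to `p`. It identifies the tame quotient of the inertia group with a commutative group. -/
noncomputable def kummerHom : (Ω ≃ₐ[LaurentSeries k] Ω) →* (tameRoots k Ω p → Ωˣ) where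
  toFun σ y := Units.mk0 (σ y / y) (div_ne_zero
    ((map_ne_zero σ).2 (ne_zero_of_mem_tameRoots y.2)) (ne_zero_of_mem_tameRoots y.2))
  map_one' := by
    ext y
    simp [ne_zero_of_mem_tameRoots y.2]
  map_mul' σ τ := by
    ext y
    have h0 := ne_zero_of_mem_tameRoots y.2
    obtain ⟨a, ha⟩ := exists_algebraMap_C_eq_apply_div τ y.2
    have h := congrArg σ ha
    rw [AlgEquiv.commutes, ha, map_div₀] at h
    have h1 : σ (y : Ω) ≠ 0 := (map_ne_zero σ).2 h0
    simp only [AlgEquiv.mul_apply, Pi.mul_apply, Units.val_mul, Units.val_mk0]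
    rw [h]
    field_simp

theorem kummerHom_apply (σ : Ω ≃ₐ[LaurentSeries k] Ω) (y : tameRoots k Ω p) :
    (kummerHom k Ω p σ y : Ω) = σ y / y := rfl

/-- The tame closure lies in the fixed field of `σ` as soon as its generators do. -/
theorem mem_wildInertia_of_kummerHom_eq_one {σ : Ω ≃ₐ[LaurentSeries k] Ω}
    (hσ : kummerHom k Ω p σ = 1) : σ ∈ wildInertia k Ω p := by
  have hle : tameClosure k Ω p ≤ IntermediateField.fixedField (Subgroup.zpowers σ) := by
    rw [tameClosure, IntermediateField.adjoin_le_iff]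
    intro y hy
    have h := congrArg Units.val (congrFun hσ ⟨y, hy⟩)
    rw [kummerHom_apply] at h
    have h2 : σ ∈ MulAction.stabilizer (Ω ≃ₐ[LaurentSeries k] Ω) y :=
      (div_eq_one_iff_eq (ne_zero_of_mem_tameRoots hy)).1 h
    rintro ⟨τ, hτ⟩
    exact (Subgroup.zpowers_le.2 h2) hτ
  exact (IntermediateField.le_iff_le _ _).1 hle (Subgroup.mem_zpowers σ)

variable (k Ω p) in
/-- A tame character takes equal values on families with equal products in the tame quotient. -/
theorem prod_eq_of_prod_kummerHom_eq {E M : Type*} [Field E] [Fintype M]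
    (δ : (Ω ≃ₐ[LaurentSeries k] Ω) →* E) (hδ : ∀ σ ∈ wildInertia k Ω p, δ σ = 1)
    (τ : M → (Ω ≃ₐ[LaurentSeries k] Ω)) (σ : Ω ≃ₐ[LaurentSeries k] Ω)
    (h : ∏ a, kummerHom k Ω p (τ a) = kummerHom k Ω p σ) : ∏ a, δ (τ a) = δ σ := by
  -- The Galois group is not commutative, so the factors are multiplied in an arbitrary order.
  set g := (Finset.univ.toList.map τ).prod with hg
  have h1 : kummerHom k Ω p g = kummerHom k Ω p σ := by
    rw [← h, hg, map_list_prod, List.map_map, ← Finset.prod_map_toList]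
    rfl
  have h2 : δ g = ∏ a, δ (τ a) := by
    rw [hg, map_list_prod, List.map_map, ← Finset.prod_map_toList]
    rfl
  have h3 := hδ (g * σ⁻¹) (mem_wildInertia_of_kummerHom_eq_one
    (by rw [map_mul, map_inv, h1, mul_inv_cancel]))
  rw [← h2, ← mul_one (δ σ), ← map_one δ, ← inv_mul_cancel_right g σ, map_mul, h3]
  simp

/-- The Kummer character `σ ↦ σ x / x` of `x = t ^ (1 / r)`. -/
noncomputable def kummerChar {r : ℕ} (hrp : r.Coprime p) {x : Ω}
    (hx : x ^ r = algebraMap (LaurentSeries k) Ω (coord k)) :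
    (Ω ≃ₐ[LaurentSeries k] Ω) →* rootsOfUnity r Ω :=
  ((Pi.evalMonoidHom _ (⟨x, r, hrp, hx⟩ : tameRoots k Ω p)).comp (kummerHom k Ω p)).codRestrict _
    fun σ => by
      rw [mem_rootsOfUnity']
      change (σ x / x) ^ r = 1
      have h0 : x ≠ 0 := ne_zero_of_mem_tameRoots (k := k) (p := p) ⟨r, hrp, hx⟩
      rw [div_pow, ← map_pow, hx, AlgEquiv.commutes, ← hx, div_self (pow_ne_zero _ h0)]

variable {r : ℕ} {hrp : r.Coprime p} {x : Ω}
  {hx : x ^ r = algebraMap (LaurentSeries k) Ω (coord k)}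

theorem apply_eq_kummerChar_mul (σ : Ω ≃ₐ[LaurentSeries k] Ω) :
    σ x = (kummerChar hrp hx σ : Ωˣ) * x :=
  (div_mul_cancel₀ _ (ne_zero_of_mem_tameRoots (k := k) (p := p) ⟨r, hrp, hx⟩)).symm

theorem card_rootsOfUnity_of_coprime (k Ω : Type*) [Field k] [Field Ω]
    [Algebra (LaurentSeries k) Ω] [IsAlgClosed k] [CharP k p] (hrp : r.Coprime p) [NeZero r] :
    Nat.card (rootsOfUnity r Ω) = r := by
  obtain ⟨ζ, hζ⟩ := exists_isPrimitiveRoot (k := k) (Ω := Ω)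
    (natCast_ne_zero_of_coprime (k := k) hrp)
  exact hζ.card_rootsOfUnity

/-- The covering `u ^ r = t` is connected: if `d` is the order of the image of the Kummer
character, then `t ^ (d / r)` is a Laurent series, and so `r` divides `d`. -/
theorem kummerChar_surjective [IsSepClosure (LaurentSeries k) Ω] [NeZero r] :
    Function.Surjective (kummerChar hrp hx) := by
  have : IsGalois (LaurentSeries k) Ω := IsSepClosure.isGalois
  rw [← MonoidHom.range_eq_top]
  set C := (kummerChar hrp hx).range with hC
  have hcard : Nat.card (rootsOfUnity r Ω) = r := by
    rw [card_rootsOfUnity_of_coprime (p := p) k Ω hrp]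
  have hfix : ∀ σ : Ω ≃ₐ[LaurentSeries k] Ω, σ (x ^ Nat.card C) = x ^ Nat.card C := by
    intro σ
    have h1 : kummerChar hrp hx σ ^ Nat.card C = 1 :=
      congrArg Subtype.val (pow_card_eq_one' (x := (⟨_, σ, rfl⟩ : C)))
    have h2 : (((kummerChar hrp hx σ : Ωˣ) : Ω)) ^ Nat.card C = 1 := by
      simpa using congrArg (fun z : rootsOfUnity r Ω => ((z : Ωˣ) : Ω)) h1
    rw [map_pow, apply_eq_kummerChar_mul (hrp := hrp) (hx := hx) σ, mul_pow, h2, one_mul]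
  obtain ⟨a, ha⟩ := (InfiniteGalois.mem_range_algebraMap_iff_fixed _).2 hfix
  have h3 : a ^ r = coord k ^ Nat.card C := by
    apply (algebraMap (LaurentSeries k) Ω).injective
    rw [map_pow, ha, ← pow_mul, mul_comm, pow_mul, hx, map_pow]
  have h4 : (r : ℤ) ∣ Nat.card C := by
    have h := congrArg HahnSeries.order h3
    rw [HahnSeries.order_pow, HahnSeries.order_pow, coord,
      HahnSeries.order_single one_ne_zero] at h
    exact ⟨a.order, by simpa using h.symm⟩
  apply Subgroup.eq_top_of_card_eq
  rw [hcard]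
  refine Nat.dvd_antisymm ?_ (by exact_mod_cast h4)
  exact (Subgroup.card_subgroup_dvd_card C).trans hcard.dvd

/-- The sign of the permutation of the `r` points of a geometric fibre of `u ^ r = t`. -/
theorem sign_mulRight_kummerChar (E : Type*) [Field E] [NeZero r] [Fintype (rootsOfUnity r Ω)]
    [DecidableEq (rootsOfUnity r Ω)]
    (σ : Ω ≃ₐ[LaurentSeries k] Ω) :
    ((Equiv.Perm.sign (Equiv.mulRight (kummerChar hrp hx σ)) : ℤ) : E) =
      quadraticChar E (coord k) σ ^ (r - 1) := by
  have hcard := card_rootsOfUnity_of_coprime (p := p) k Ω hrp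
  obtain ⟨g, hg⟩ := IsCyclic.exists_generator (α := rootsOfUnity r Ω)
  obtain ⟨j, hj⟩ := (mem_powers_iff_mem_zpowers.2 (hg (kummerChar hrp hx σ)))
  simp only at hj
  have hsign : Equiv.Perm.sign (Equiv.mulRight (kummerChar hrp hx σ)) = ((-1) ^ (r - 1)) ^ j := by
    rw [← hj, ← Equiv.pow_mulRight, map_pow, sign_mulRight_of_forall_mem_zpowers hg,
      ← Nat.card_eq_fintype_card, hcard]
  have hq : quadraticChar E (coord k) σ = 1 ∨ quadraticChar E (coord k) σ = -1 := by
    classical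
    change (if _ then (1 : E) else -1) = 1 ∨ (if _ then (1 : E) else -1) = -1
    split_ifs <;> simp
  have hr0 : r ≠ 0 := NeZero.ne r
  rw [hsign]
  rcases Nat.even_or_odd r with hr | hr
  · obtain ⟨h, hh⟩ := hr
    have hp2 : p ≠ 2 := by
      rintro rfl
      rw [Nat.coprime_two_right] at hrp
      exact (Nat.not_even_iff_odd.2 hrp) ⟨h, hh⟩
    have hchar : CharP Ω p := charP_of_injective_ringHom
      (((algebraMap (LaurentSeries k) Ω).comp (HahnSeries.C (Γ := ℤ) (R := k))).injective) p
    have hneg : (-1 : Ω) ≠ 1 := by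
      have : (2 : Ω) ≠ 0 := by
        exact_mod_cast natCast_ne_zero_of_coprime (k := Ω) (p := p) (m := 2)
          ((Nat.coprime_primes Nat.prime_two hp.out).2 hp2.symm)
      intro hn
      apply this
      linear_combination -hn
    -- A generator `g` of `μ_r` has order `2 * h`, and `x ^ h` is a square root of the coordinate.
    have hgh : ((g : Ωˣ) : Ω) ^ h = -1 := by
      have hord : orderOf g = r := by
        rw [orderOf_eq_card_of_forall_mem_zpowers hg, hcard]
      have h1 : (((g : Ωˣ) : Ω) ^ h) ^ 2 = 1 := by
        have h2 : ((g : Ωˣ) : Ω) ^ r = 1 := (mem_rootsOfUnity' _ _).1 g.2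
        rw [← pow_mul, mul_two, ← hh, h2]
      rcases sq_eq_sq_iff_eq_or_eq_neg.1 (h1.trans (one_pow 2).symm) with h2 | h2
      · have h3 : g ^ h = 1 := by
          ext
          simpa using h2
        have h4 := Nat.le_of_dvd (by omega) (orderOf_dvd_of_pow_eq_one h3)
        omega
      · exact h2
    have hs0 : (x ^ h) ^ 2 = algebraMap (LaurentSeries k) Ω (coord k) := by
      rw [← pow_mul, mul_two, ← hh, hx]
    have hσ : σ (x ^ h) = (-1) ^ j * x ^ h := by
      rw [map_pow, apply_eq_kummerChar_mul (hrp := hrp) (hx := hx) σ, ← hj, mul_pow, ← hgh]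
      simp only [SubmonoidClass.coe_pow, Units.val_pow_eq_pow_val]
      ring
    have hx0 : x ^ h ≠ 0 :=
      pow_ne_zero _ (ne_zero_of_mem_tameRoots (k := k) (p := p) ⟨r, hrp, hx⟩)
    have hodd : Odd (r - 1) := ⟨h - 1, by omega⟩
    have hquad : quadraticChar E (coord k) σ = (-1) ^ j := by
      classical
      change (if _ then (1 : E) else -1) = (-1) ^ j
      rcases Nat.even_or_odd j with he | ho
      · rw [he.neg_one_pow, one_mul] at hσ
        rw [he.neg_one_pow, if_pos]
        intro s hs
        rcases sq_eq_sq_iff_eq_or_eq_neg.1 (hs.trans hs0.symm) with h' | h' <;> rw [h']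
        · exact hσ
        · rw [map_neg, hσ]
      · rw [ho.neg_one_pow] at hσ
        rw [ho.neg_one_pow, if_neg]
        intro hall
        rw [hall _ hs0] at hσ
        exact hneg (mul_right_cancel₀ hx0 (by rw [← hσ, one_mul]))
    rw [hquad, hodd.neg_one_pow, ← pow_mul, mul_comm, pow_mul, hodd.neg_one_pow]
    simp
  · have heven : Even (r - 1) := by
      obtain ⟨h, hh⟩ := hr
      exact ⟨h, by omega⟩
    rw [heven.neg_one_pow]
    rcases hq with hq | hq <;> rw [hq]
    · simp
    · simp [heven.neg_one_pow]

end Kummer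

end Disc

/-! ### The transfer along the covering `u ^ r = t` -/

section Covering

variable {k : Type*} [Field k] {Ω : Type*} [Field Ω] [Algebra (LaurentSeries k) Ω]
  {r : ℕ} {hr : 0 < r} (Θ : Ω ≃+* Ω)

theorem symm_algebraMap_powSubst
    (hΘ : ∀ f : LaurentSeries k, Θ (algebraMap (LaurentSeries k) Ω f) =
      algebraMap (LaurentSeries k) Ω (powSubst k r hr f))
    (f : LaurentSeries k) :
    Θ.symm (algebraMap (LaurentSeries k) Ω (powSubst k r hr f)) =
      algebraMap (LaurentSeries k) Ω f := by
  rw [← hΘ, RingEquiv.symm_apply_apply]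

theorem symm_algebraMap_C
    (hΘ : ∀ f : LaurentSeries k, Θ (algebraMap (LaurentSeries k) Ω f) =
      algebraMap (LaurentSeries k) Ω (powSubst k r hr f))
    (a : k) :
    Θ.symm (algebraMap (LaurentSeries k) Ω (HahnSeries.C a)) =
      algebraMap (LaurentSeries k) Ω (HahnSeries.C a) := by
  conv_lhs => rw [← powSubst_C r hr a]
  exact symm_algebraMap_powSubst Θ hΘ _

theorem symm_algebraMap_coord_pow
    (hΘ : ∀ f : LaurentSeries k, Θ (algebraMap (LaurentSeries k) Ω f) =
      algebraMap (LaurentSeries k) Ω (powSubst k r hr f)) :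
    Θ.symm (algebraMap (LaurentSeries k) Ω (coord k)) ^ r =
      algebraMap (LaurentSeries k) Ω (coord k) := by
  rw [← map_pow, ← map_pow, ← powSubst_coord r hr, symm_algebraMap_powSubst Θ hΘ]

variable (hΘ : ∀ f : LaurentSeries k, Θ (algebraMap (LaurentSeries k) Ω f) =
    algebraMap (LaurentSeries k) Ω (powSubst k r hr f))

theorem coverHom_apply (τ : Ω ≃ₐ[LaurentSeries k] Ω) (z : Ω) :
    coverHom Θ hΘ τ z = Θ.symm (τ (Θ z)) := rfl

theorem apply_eq_coverHom (τ : Ω ≃ₐ[LaurentSeries k] Ω) (y : Ω) :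
    τ y = Θ (coverHom Θ hΘ τ (Θ.symm y)) := by
  rw [coverHom_apply, RingEquiv.apply_symm_apply, RingEquiv.apply_symm_apply]

theorem coverHom_injective : Function.Injective (coverHom Θ hΘ) := fun τ τ' h => by
  ext y
  rw [apply_eq_coverHom Θ hΘ, h, ← apply_eq_coverHom Θ hΘ]

variable {p : ℕ} [hp : Fact p.Prime] [IsAlgClosed k] [CharP k p] (hrp : r.Coprime p)

/-- The image of `coverHom` is the subgroup fixing `t ^ (1 / r)`, because `k((u))` is generated by
`u` over `k((t))`. -/
theorem ker_kummerChar_eq_range_coverHom :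
    (kummerChar hrp (symm_algebraMap_coord_pow Θ hΘ)).ker = (coverHom Θ hΘ).range := by
  have hx := symm_algebraMap_coord_pow Θ hΘ
  have hx0 := ne_zero_of_mem_tameRoots (k := k) (p := p) ⟨r, hrp, hx⟩
  ext σ
  have hiff : σ ∈ (kummerChar hrp hx).ker ↔
      σ (Θ.symm (algebraMap _ Ω (coord k))) = Θ.symm (algebraMap _ Ω (coord k)) := by
    rw [MonoidHom.mem_ker, apply_eq_kummerChar_mul (hrp := hrp) (hx := hx) σ,
      mul_eq_right₀ hx0, Units.val_eq_one, OneMemClass.coe_eq_one]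
  rw [hiff]
  constructor
  · intro hσ
    refine ⟨AlgEquiv.ofRingEquiv (f := (Θ.symm.trans σ.toRingEquiv).trans Θ) fun f => ?_, ?_⟩
    · change Θ (σ (Θ.symm (algebraMap _ Ω f))) = algebraMap _ Ω f
      rw [← RingEquiv.eq_symm_apply]
      obtain ⟨g, rfl⟩ := exists_eq_sum_powSubst_mul_coord_pow r hr f
      simp only [map_sum, map_mul, map_pow, symm_algebraMap_powSubst Θ hΘ, hσ, AlgEquiv.commutes]
    · ext z
      change Θ.symm (Θ (σ (Θ.symm (Θ z)))) = σ z
      simp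
  · rintro ⟨τ, rfl⟩
    rw [coverHom_apply, RingEquiv.apply_symm_apply, AlgEquiv.commutes]

variable {s : rootsOfUnity r Ω → (Ω ≃ₐ[LaurentSeries k] Ω)}

theorem algebraMap_traceAlong_powSubst [IsSepClosure (LaurentSeries k) Ω]
    [Fintype (rootsOfUnity r Ω)]
    (hs : ∀ a, kummerChar hrp (symm_algebraMap_coord_pow Θ hΘ) (s a) = a) (f : LaurentSeries k) :
    algebraMap (LaurentSeries k) Ω (traceAlong (powSubst k r hr) f) =
      ∑ a, (s a)⁻¹ (Θ.symm (algebraMap (LaurentSeries k) Ω f)) := by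
  have : Algebra.IsSeparable (LaurentSeries k) Ω := IsSepClosure.separable
  have : NeZero r := ⟨hr.ne'⟩
  have hcard : Fintype.card (rootsOfUnity r Ω) = r := by
    rw [← Nat.card_eq_fintype_card, card_rootsOfUnity_of_coprime (p := p) k Ω hrp]
  refine algebraMap_traceAlong_eq_sum (powSubst k r hr) (u := coord k)
    (fun a => ((((s a)⁻¹ : Ω ≃ₐ[LaurentSeries k] Ω) : Ω →+* Ω).comp (Θ.symm : Ω →+* Ω)).comp
      (algebraMap (LaurentSeries k) Ω)) (fun a g => ?_) (fun z => ?_) (fun a b hab => ?_) f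
  · change (s a)⁻¹ (Θ.symm (algebraMap _ Ω (powSubst k r hr g))) = _
    rw [symm_algebraMap_powSubst Θ hΘ, AlgEquiv.commutes]
  · rw [hcard]
    exact exists_eq_sum_powSubst_mul_coord_pow r hr z
  · have hx := symm_algebraMap_coord_pow Θ hΘ
    have hx0 := ne_zero_of_mem_tameRoots (k := k) (p := p) ⟨r, hrp, hx⟩
    change (s a)⁻¹ (Θ.symm (algebraMap _ Ω (coord k))) =
      (s b)⁻¹ (Θ.symm (algebraMap _ Ω (coord k))) at hab
    rw [apply_eq_kummerChar_mul (hrp := hrp) (hx := hx) (s a)⁻¹,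
      apply_eq_kummerChar_mul (hrp := hrp) (hx := hx) (s b)⁻¹, map_inv, map_inv, hs, hs] at hab
    exact inv_injective (Subtype.ext (Units.ext (mul_right_cancel₀ hx0 hab)))

variable [Fintype (rootsOfUnity r Ω)]
  {τ : rootsOfUnity r Ω → (Ω ≃ₐ[LaurentSeries k] Ω)} {σ : Ω ≃ₐ[LaurentSeries k] Ω}

/-- The transfer of the Artin-Schreier character of `f` is that of `Tr f`: if `z` is a root of the
Artin-Schreier equation of `f`, transported by `Θ`, the sum `w` of its conjugates is a root of the
equation of `Tr f`. -/
theorem prod_artinSchreierChar_pow {E : Type*} [Field E] [Algebra (ZMod p) k]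
    [IsSepClosure (LaurentSeries k) Ω]
    (hs : ∀ a, kummerChar hrp (symm_algebraMap_coord_pow Θ hΘ) (s a) = a)
    (hτ : ∀ a, coverHom Θ hΘ (τ a) =
      s a * σ * (s (a * kummerChar hrp (symm_algebraMap_coord_pow Θ hΘ) σ))⁻¹)
    (ψ : AddChar (ZMod p) E) (f : LaurentSeries k) (n : ℕ) :
    ∏ a, artinSchreierChar p ψ f (τ a) ^ n =
      artinSchreierChar p ψ (n • traceAlong (powSubst k r hr) f) σ := by
  have : CharP (LaurentSeries k) p :=
    charP_of_injective_algebraMap (algebraMap (ZMod p) (LaurentSeries k)).injective p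
  have : CharP Ω p := charP_of_injective_algebraMap (algebraMap (LaurentSeries k) Ω).injective p
  set c := kummerChar hrp (symm_algebraMap_coord_pow Θ hΘ)
  set y := artinSchreierRoot Ω p f with hy
  have hyf : y ^ p - y = algebraMap _ Ω f := artinSchreierRoot_spec (Ω := Ω) p f
  set w : Ω := ∑ a, (s a)⁻¹ (Θ.symm y) with hw
  have hwf : w ^ p - w = algebraMap _ Ω (traceAlong (powSubst k r hr) f) := by
    rw [algebraMap_traceAlong_powSubst Θ hΘ hrp hs, hw, sum_pow_char, ← Finset.sum_sub_distrib]
    refine Finset.sum_congr rfl fun a _ => ?_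
    rw [← hyf, map_sub, map_sub, map_pow, map_pow]
  have hdiff : ∀ a, algebraMap (LaurentSeries k) Ω (algebraMap (ZMod p) (LaurentSeries k)
      (artinSchreierDifference p f (τ a))) =
        σ ((s (a * c σ))⁻¹ (Θ.symm y)) - (s a)⁻¹ (Θ.symm y) := by
    intro a
    have h1 := artinSchreierDifference_spec p f (τ a)
    rw [← hy, apply_eq_coverHom Θ hΘ, hτ] at h1
    -- The difference lies in the prime field, so it is unchanged by `(s a)⁻¹ ∘ Θ⁻¹`.
    have h2 := congrArg (fun z => (s a)⁻¹ (Θ.symm z)) h1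
    have h3 : Θ.symm (algebraMap (LaurentSeries k) Ω (algebraMap (ZMod p) (LaurentSeries k)
        (artinSchreierDifference p f (τ a)))) = algebraMap (LaurentSeries k) Ω
          (algebraMap (ZMod p) (LaurentSeries k) (artinSchreierDifference p f (τ a))) :=
      DFunLike.congr_fun (Subsingleton.elim
        ((Θ.symm : Ω →+* Ω).comp ((algebraMap (LaurentSeries k) Ω).comp (algebraMap (ZMod p) _)))
        ((algebraMap (LaurentSeries k) Ω).comp (algebraMap (ZMod p) _))) _
    simp only [h3, AlgEquiv.commutes, map_sub, RingEquiv.symm_apply_apply] at h2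
    rw [h2, ← AlgEquiv.mul_apply, ← AlgEquiv.mul_apply, mul_assoc, inv_mul_cancel_left]
  have hsum : algebraMap (LaurentSeries k) Ω (algebraMap (ZMod p) (LaurentSeries k)
      (∑ a, artinSchreierDifference p f (τ a))) = σ w - w := by
    simp only [map_sum, hdiff, Finset.sum_sub_distrib, hw]
    congr 1
    exact Equiv.sum_comp (Equiv.mulRight (c σ)) fun a => σ ((s a)⁻¹ (Θ.symm y))
  have hnw : (n • w) ^ p - n • w = algebraMap _ Ω (n • traceAlong (powSubst k r hr) f) := by
    have h : ((n : Ω)) ^ p = n := map_natCast (frobenius Ω p) n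
    rw [map_nsmul, ← hwf, nsmul_eq_mul, nsmul_eq_mul, mul_pow, h]
    ring
  rw [artinSchreierChar_apply p ψ hnw (a := n • ∑ a, artinSchreierDifference p f (τ a))
    (by rw [map_nsmul, map_nsmul, hsum, map_nsmul, nsmul_sub]), Finset.prod_pow,
    AddChar.map_nsmul_eq_pow]
  congr 1
  exact (map_prod ψ.toMonoidHom (fun a => Multiplicative.ofAdd
    (artinSchreierDifference p f (τ a))) Finset.univ).symm

/-- The transfer of a tame character `δ` is `δ` itself: on the commutative tame quotient the
transfer is `σ ↦ σ ^ r`, and so is the homomorphism `coverHom`. -/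
theorem prod_tame_eq {E : Type*} [Field E]
    (hτ : ∀ a, coverHom Θ hΘ (τ a) =
      s a * σ * (s (a * kummerChar hrp (symm_algebraMap_coord_pow Θ hΘ) σ))⁻¹)
    (δ : (Ω ≃ₐ[LaurentSeries k] Ω) →* E) (hδ : ∀ σ ∈ wildInertia k Ω p, δ σ = 1) :
    ∏ a, δ (τ a) = δ σ := by
  have : NeZero r := ⟨hr.ne'⟩
  have hcard : Fintype.card (rootsOfUnity r Ω) = r := by
    rw [← Nat.card_eq_fintype_card, card_rootsOfUnity_of_coprime (p := p) k Ω hrp]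
  refine prod_eq_of_prod_kummerHom_eq k Ω p δ hδ τ σ (funext fun y => Units.ext ?_)
  have hy0 := ne_zero_of_mem_tameRoots y.2
  obtain ⟨m, hm, hy⟩ := y.2
  have hzm : Θ.symm (y : Ω) ^ (r * m) = algebraMap _ Ω (coord k) := by
    rw [mul_comm, pow_mul, ← map_pow, hy, symm_algebraMap_coord_pow Θ hΘ]
  let z : tameRoots k Ω p := ⟨Θ.symm y, r * m, hrp.mul_left hm, hzm⟩
  have hz0 := ne_zero_of_mem_tameRoots z.2
  have h1 : ∀ a, kummerHom k Ω p (τ a) y = kummerHom k Ω p (coverHom Θ hΘ (τ a)) z := by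
    intro a
    ext
    obtain ⟨b, hb⟩ := exists_algebraMap_C_eq_apply_div (τ a) y.2
    rw [kummerHom_apply, kummerHom_apply, coverHom_apply, ← hb, ← symm_algebraMap_C Θ hΘ, hb,
      map_div₀]
    change _ = Θ.symm (τ a (Θ (Θ.symm y))) / Θ.symm y
    rw [RingEquiv.apply_symm_apply]
  have h2 : (∏ a, kummerHom k Ω p (τ a)) y = kummerHom k Ω p σ z ^ r := by
    rw [Finset.prod_apply]
    simp only [h1, hτ, map_mul, map_inv, Pi.mul_apply, Pi.inv_apply, Finset.prod_mul_distrib,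
      Finset.prod_inv_distrib, Finset.prod_const, Finset.card_univ, hcard]
    have h := Equiv.prod_comp (Equiv.mulRight (kummerChar hrp (symm_algebraMap_coord_pow Θ hΘ) σ))
      fun a => kummerHom k Ω p (s a) z
    simp only [Equiv.coe_mulRight] at h
    rw [h, mul_inv_cancel_comm]
  -- The roots `y` and `z ^ r` of the coordinate differ by a constant factor.
  obtain ⟨b, hb⟩ := exists_algebraMap_C_eq_div (k := k) (p := p) hm (x := (z : Ω) ^ r)
    (y := (y : Ω)) (by rw [← pow_mul, hzm, hy]) hy0
  have h3 : (z : Ω) ^ r = algebraMap (LaurentSeries k) Ω (HahnSeries.C b) * y := by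
    rw [hb, div_mul_cancel₀ _ hy0]
  have hb0 : algebraMap (LaurentSeries k) Ω (HahnSeries.C b) ≠ 0 := by
    rw [hb]
    exact div_ne_zero (pow_ne_zero _ hz0) hy0
  rw [h2, Units.val_pow_eq_pow_val, kummerHom_apply, kummerHom_apply, div_pow, ← map_pow, h3,
    map_mul, AlgEquiv.commutes, mul_div_mul_left _ _ hb0]

end Covering

end WildLocal

/-! ### The determinant of the direct image -/

theorem proposition4p1
    (p ℓ : ℕ) [Fact p.Prime] [Fact ℓ.Prime] (hℓ : ℓ ≠ p)
    -- `k` is an algebraic closure of `𝔽_p`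
    (k : Type*) [Field k] [Algebra (ZMod p) k] [IsAlgClosure (ZMod p) k]
    -- a separable closure of `k((X))`
    (Ω : Type*) [Field Ω] [Algebra (LaurentSeries k) Ω] [IsSepClosure (LaurentSeries k) Ω]
    (ψ : AddChar (ZMod p) (PadicAlgCl ℓ)) (hψ : ψ ≠ 1)
    (r : ℕ) (hr : 0 < r) (hrp : r.Coprime p)
    -- an arbitrary extension of `k((t)) → k((u))`, `t ↦ u ^ r`, to the separable closures
    (Θ : Ω ≃+* Ω)
    (hΘ : ∀ f : LaurentSeries k, Θ (algebraMap (LaurentSeries k) Ω f) =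
      algebraMap (LaurentSeries k) Ω (WildLocal.powSubst k r hr f))
    -- `φ(u)` is a polynomial in `u⁻¹`
    (φ : Polynomial k) (φu : LaurentSeries k)
    (hφu : φu = Polynomial.aeval (WildLocal.coord k)⁻¹ φ)
    -- `κ` is the representation of the tamely ramified sheaf `𝒦`
    {V : Type*} [AddCommGroup V] [Module (PadicAlgCl ℓ) V] [FiniteDimensional (PadicAlgCl ℓ) V]
    (κ : Representation (PadicAlgCl ℓ) (Ω ≃ₐ[LaurentSeries k] Ω) V)
    (hκ : WildLocal.IsContinuousRep κ) (hκ_tame : WildLocal.IsTame p κ)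
    (n : ℕ) (hn : n = Module.finrank (PadicAlgCl ℓ) V) :
    FiniteDimensional (PadicAlgCl ℓ)
      (Representation.coindV (WildLocal.coverHom Θ hΘ)
        (WildLocal.twist (WildLocal.artinSchreierChar p ψ φu) κ)) ∧
    ∀ σ : Ω ≃ₐ[LaurentSeries k] Ω,
      LinearMap.det
          (WildLocal.directImage Θ hΘ
            (WildLocal.twist (WildLocal.artinSchreierChar p ψ φu) κ) σ) =
        WildLocal.quadraticChar (PadicAlgCl ℓ) (WildLocal.coord k) σ ^ ((r - 1) * n) *
          WildLocal.artinSchreierChar p ψ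
            (n • WildLocal.traceAlong (WildLocal.powSubst k r hr) φu) σ *
          LinearMap.det (κ σ) := by

  classical
  have : IsAlgClosed k := IsAlgClosure.isAlgClosed (ZMod p)
  have : CharP k p := charP_of_injective_algebraMap (algebraMap (ZMod p) k).injective p
  have : NeZero r := ⟨hr.ne'⟩
  have : Fintype (rootsOfUnity r Ω) := Fintype.ofFinite _
  have hx := WildLocal.symm_algebraMap_coord_pow Θ hΘ
  obtain ⟨s, hs⟩ :=
    (WildLocal.kummerChar_surjective (k := k) (hrp := hrp) (hx := hx)).hasRightInverse
  have hι := WildLocal.coverHom_injective Θ hΘ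
  have hker := WildLocal.ker_kummerChar_eq_range_coverHom Θ hΘ hrp
  refine ⟨(WildLocal.coindVEquivPi hι hker hs _).symm.finiteDimensional, fun σ => ?_⟩
  have hτ : ∀ a, ∃ τ, WildLocal.coverHom Θ hΘ τ =
      s a * σ * (s (a * WildLocal.kummerChar hrp hx σ))⁻¹ := by
    intro a
    obtain ⟨τ, hτ⟩ := WildLocal.exists_map_eq_mul_section_inv hker hs (s a * σ)
    exact ⟨τ, by rw [hτ, map_mul, hs]⟩
  choose τ hτ using hτ
  have hdet : ∀ a, LinearMap.det (WildLocal.twist (WildLocal.artinSchreierChar p ψ φu) κ (τ a)) =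
      WildLocal.artinSchreierChar p ψ φu (τ a) ^ n * LinearMap.det (κ (τ a)) := by
    intro a
    rw [hn]
    exact LinearMap.det_smul _ _
  rw [WildLocal.det_coind hι hker hs _ σ τ hτ, WildLocal.sign_mulRight_kummerChar, ← hn, ← pow_mul,
    Finset.prod_congr rfl fun a _ => hdet a, Finset.prod_mul_distrib,
    WildLocal.prod_artinSchreierChar_pow Θ hΘ hrp hs hτ, mul_assoc]
  congr 2
  exact WildLocal.prod_tame_eq Θ hΘ hrp hτ (LinearMap.det.comp κ) fun ρ hρ => by
    rw [MonoidHom.comp_apply, hκ_tame ρ hρ, map_one]
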